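/- For $n\ge 1$ and a permutation $a=(a_1,\dots,a_n)$ of $[n]=\{1,\dots,n\}$, let $$L(a)=\Big\{(u,v)\in[n]^2 : u\le v,\ \sum_{i=u}^v a_i\ge \tfrac12\tbinom{n+1}{2}\Big\}.$$ Then $|L(a)|\le\big(\tfrac{\pi}{16}+o(1)\big)n^2$ as $n\to\infty$, where the $o(1)$ term depends only on $n$ (it is uniform over all permutations $a$ of $[n]$). Moreover, the constant $\tfrac{\pi}{16}$ cannot be improved: for every $n$, the tent sequence $t^{(n)}$ defined by $t^{(n)}_i=2i$ for $i\le n/2$ and $t^{(n)}_i=2(n-i)+1$ for $n/2<i\le n$ is a permutation of $[n]$, and $|L(t^{(n)})|/n^2\to\tfrac{\pi}{16}$ as $n\to\infty$. -/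

import Mathlib

open Filter Topology

/-- `a` is a permutation of `[n] = {1, …, n}`, written as a sequence `a 1, …, a n`
(the values of `a` outside `[n]` play no role). -/
def IsPermOf (n : ℕ) (a : ℕ → ℕ) : Prop :=
  Set.BijOn a (Set.Icc 1 n) (Set.Icc 1 n)

/-- The set `L(a)` of pairs `(u, v) ∈ [n]²` with `u ≤ v` and
`∑_{i=u}^v a_i ≥ (1/2) * binom(n+1, 2)`; the inequality is between real numbers. -/
noncomputable def largeSums (n : ℕ) (a : ℕ → ℕ) : Finset (ℕ × ℕ) :=
  open Classical in
  (Finset.Icc 1 n ×ˢ Finset.Icc 1 n).filter fun p =>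
    p.1 ≤ p.2 ∧
      (1 / 2 : ℝ) * ((n + 1).choose 2 : ℝ) ≤ ∑ i ∈ Finset.Icc p.1 p.2, (a i : ℝ)

/-- The tent permutation of `[n]`: `a_i = 2 i` for `i ≤ n / 2` and `a_i = 2 (n - i) + 1`
for `i > n / 2` (the subtraction does not truncate on `[n]`). -/
def tentPerm (n : ℕ) (i : ℕ) : ℕ :=
  if 2 * i ≤ n then 2 * i else 2 * (n - i) + 1

/-! Encode an interval by the numbers `j`, `k` of terms cut off before and after it. It is large iff
the cut-off terms sum to at most half the total, so these pairs form a lower set `D`. Distinct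
positive integers have a large sum: `m` of them sum to at least `m² / 2`. Applied to the prefix of
one pair of `D` joined with the suffix of another, and vice versa, this gives `(j + k')² + (j' + k)²
≤ (n + 1)²` (`IsPermOf.add_sq_le`). `card_le_of_isLowerSet` turns this into an area bound by the
transport proof of Brunn–Minkowski: columns and rows of `D` at the same relative position are
paired, and the sum of their lengths is bounded by a circular arc. For the tent, `D` itself is
nearly a quarter disc of radius `n / 2`, giving equality in the limit. -/

theorem mem_iff_lt_card_of_isLowerSet {s : Finset ℕ} (hs : IsLowerSet (s : Set ℕ)) (k : ℕ) :
    k ∈ s ↔ k < s.card := by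
  constructor
  · intro hk
    have h : Finset.range (k + 1) ⊆ s := fun i hi =>
      hs (Nat.lt_succ_iff.mp (Finset.mem_range.mp hi)) hk
    simpa using Finset.card_le_card h
  · intro hk
    by_contra hks
    have h : s ⊆ Finset.range k := fun i hi => by
      rw [Finset.mem_range]
      by_contra hik
      exact hks (hs (not_lt.mp hik) hi)
    have := Finset.card_le_card h
    simp at this
    omega

/-- Stretching `b` columns and `a` rows to the common index range `a * b` lets them be paired term
by term. -/
theorem sum_range_mul_div (f : ℕ → ℝ) {a : ℕ} (ha : 0 < a) (b : ℕ) :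
    ∑ r ∈ Finset.range (a * b), f (r / a) = a * ∑ j ∈ Finset.range b, f j := by
  induction b with
  | zero => simp
  | succ b ih =>
    rw [Nat.mul_succ, Finset.sum_range_add, ih, Finset.sum_range_succ, mul_add]
    congr 1
    rw [Finset.sum_congr rfl (g := fun _ => f b)]
    · simp
    · intro x hx
      rw [Nat.mul_add_div ha, Nat.div_eq_of_lt (Finset.mem_range.mp hx), add_zero]

/-! ### Quarter-circle integrals and Riemann sums -/

theorem antitoneOn_sqrt_sq_sub_sq (R : ℝ) :
    AntitoneOn (fun x : ℝ => √(R ^ 2 - x ^ 2)) (Set.Ici 0) := by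
  intro x hx y _ hxy
  have hx : 0 ≤ x := hx
  exact Real.sqrt_le_sqrt (by nlinarith)

theorem integral_sqrt_sq_sub_sq_self {R : ℝ} (hR : 0 ≤ R) :
    ∫ x in (0 : ℝ)..R, √(R ^ 2 - x ^ 2) = Real.pi / 4 * R ^ 2 := by
  have hc : Continuous fun x : ℝ => √(1 - x ^ 2) := by fun_prop
  have h1 : ∫ x in (0 : ℝ)..1, √(1 - x ^ 2) = Real.pi / 4 := by
    have h := integral_sqrt_one_sub_sq
    rw [← intervalIntegral.integral_add_adjacent_intervals (hc.intervalIntegrable (-1) 0)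
      (hc.intervalIntegrable 0 1)] at h
    have h2 := intervalIntegral.integral_comp_neg (a := 0) (b := 1) fun x : ℝ => √(1 - x ^ 2)
    simp only [neg_sq, neg_zero] at h2
    linarith
  rcases hR.eq_or_lt with rfl | hR
  · simp
  have h3 := intervalIntegral.mul_integral_comp_mul_left (a := 0) (b := 1) (c := R)
    (f := fun x : ℝ => √(R ^ 2 - x ^ 2))
  rw [mul_zero, mul_one] at h3
  rw [← h3]
  have h4 : ∀ x : ℝ, √(R ^ 2 - (R * x) ^ 2) = R * √(1 - x ^ 2) := fun x => by
    rw [show R ^ 2 - (R * x) ^ 2 = R ^ 2 * (1 - x ^ 2) by ring, Real.sqrt_mul (by positivity),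
      Real.sqrt_sq hR.le]
  simp only [h4, intervalIntegral.integral_const_mul, h1]
  ring

theorem integral_sqrt_sq_sub_sq_of_le {R c : ℝ} (hR : 0 ≤ R) (hc : R ≤ c) :
    ∫ x in (0 : ℝ)..c, √(R ^ 2 - x ^ 2) = Real.pi / 4 * R ^ 2 := by
  have hcont : Continuous fun x : ℝ => √(R ^ 2 - x ^ 2) := by fun_prop
  rw [← intervalIntegral.integral_add_adjacent_intervals (hcont.intervalIntegrable 0 R)
    (hcont.intervalIntegrable R c), integral_sqrt_sq_sub_sq_self hR]
  have : ∫ x in R..c, √(R ^ 2 - x ^ 2) = ∫ _x in R..c, (0 : ℝ) := by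
    refine intervalIntegral.integral_congr fun x hx => ?_
    rw [Set.uIcc_of_le hc] at hx
    exact Real.sqrt_eq_zero_of_nonpos (by nlinarith [hx.1])
  rw [this]
  simp

theorem integral_sqrt_sq_sub_sq_le {R c : ℝ} (hR : 0 ≤ R) (hc : 0 ≤ c) :
    ∫ x in (0 : ℝ)..c, √(R ^ 2 - x ^ 2) ≤ Real.pi / 4 * R ^ 2 := by
  have hcont : Continuous fun x : ℝ => √(R ^ 2 - x ^ 2) := by fun_prop
  rw [← integral_sqrt_sq_sub_sq_of_le hR (le_max_left R c)]
  exact intervalIntegral.integral_mono_interval le_rfl hc (le_max_right R c)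
    (Eventually.of_forall fun x => Real.sqrt_nonneg _) (hcont.intervalIntegrable _ _)

theorem sum_sqrt_sq_sub_sq_le {R δ : ℝ} (hR : 0 ≤ R) (hδ : 0 < δ) (M : ℕ) :
    δ * ∑ r ∈ Finset.range M, √(R ^ 2 - (δ * ((r + 1 : ℕ) : ℝ)) ^ 2) ≤ Real.pi / 4 * R ^ 2 := by
  have hanti : AntitoneOn (fun x : ℝ => √(R ^ 2 - (δ * x) ^ 2)) (Set.Icc (0 : ℝ) (0 + (M : ℕ))) := by
    intro x hx y hy hxy
    exact antitoneOn_sqrt_sq_sub_sq R (mul_nonneg hδ.le hx.1) (mul_nonneg hδ.le hy.1)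
      (mul_le_mul_of_nonneg_left hxy hδ.le)
  have h := hanti.sum_le_integral
  simp only [zero_add] at h
  refine (mul_le_mul_of_nonneg_left h hδ.le).trans ?_
  rw [intervalIntegral.mul_integral_comp_mul_left (f := fun x : ℝ => √(R ^ 2 - x ^ 2)), mul_zero]
  exact integral_sqrt_sq_sub_sq_le hR (by positivity)

/-! ### The area bound for lower sets -/

/-- A Brunn–Minkowski type bound: a planar lower set whose average with its transpose lies in
a quarter disc of radius `N / 2` has at most about as many points as that quarter disc. -/
theorem card_le_of_isLowerSet {D : Finset (ℕ × ℕ)} (hD : IsLowerSet (D : Set (ℕ × ℕ)))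
    {N : ℝ} (hN : 0 ≤ N)
    (h : ∀ x ∈ D, ∀ y ∈ D, ((x.1 + y.2 : ℕ) : ℝ) ^ 2 + ((y.1 + x.2 : ℕ) : ℝ) ^ 2 ≤ N ^ 2) :
    (D.card : ℝ) ≤ Real.pi / 16 * (N + 2) ^ 2 + (N / 2 + 1) := by
  classical
  rcases D.eq_empty_or_nonempty with rfl | ⟨x₀, hx₀⟩
  · simp only [Finset.card_empty, Nat.cast_zero]
    positivity
  let f : ℕ → ℕ := fun j => (D.filter fun x => x.1 = j).card
  let g : ℕ → ℕ := fun k => (D.filter fun x => x.2 = k).card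
  have hf : ∀ j k, (j, k) ∈ D ↔ k < f j := by
    intro j k
    have hcard : f j = ((D.filter fun x => x.1 = j).image Prod.snd).card := by
      refine (Finset.card_image_of_injOn ?_).symm
      rintro ⟨x1, x2⟩ hx ⟨y1, y2⟩ hy hxy
      simp only [Finset.coe_filter, Set.mem_ofPred_eq] at hx hy hxy
      simp [hx.2, hy.2, hxy]
    have hmem : ∀ i, i ∈ (D.filter fun x => x.1 = j).image Prod.snd ↔ (j, i) ∈ D := by simp
    rw [hcard, ← mem_iff_lt_card_of_isLowerSet, hmem]
    intro p q hqp hp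
    rw [Finset.mem_coe, hmem] at hp ⊢
    exact hD (Prod.mk_le_mk.mpr ⟨le_rfl, hqp⟩) hp
  have hg : ∀ j k, (j, k) ∈ D ↔ j < g k := by
    intro j k
    have hcard : g k = ((D.filter fun x => x.2 = k).image Prod.fst).card := by
      refine (Finset.card_image_of_injOn ?_).symm
      rintro ⟨x1, x2⟩ hx ⟨y1, y2⟩ hy hxy
      simp only [Finset.coe_filter, Set.mem_ofPred_eq] at hx hy hxy
      simp [hx.2, hy.2, hxy]
    have hmem : ∀ i, i ∈ (D.filter fun x => x.2 = k).image Prod.fst ↔ (i, k) ∈ D := by simp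
    rw [hcard, ← mem_iff_lt_card_of_isLowerSet, hmem]
    intro p q hqp hp
    rw [Finset.mem_coe, hmem] at hp ⊢
    exact hD (Prod.mk_le_mk.mpr ⟨hqp, le_rfl⟩) hp
  set a := f 0 with ha
  set b := g 0 with hb
  have h00 : ((0, 0) : ℕ × ℕ) ∈ D := hD (Prod.mk_le_mk.mpr ⟨zero_le, zero_le⟩) hx₀
  have ha0 : 0 < a := (hf 0 0).mp h00
  have hb0 : 0 < b := (hg 0 0).mp h00
  have hVf : (D.card : ℝ) = ∑ j ∈ Finset.range b, (f j : ℝ) := by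
    rw [Finset.card_eq_sum_card_fiberwise (f := Prod.fst) (t := Finset.range b)]
    · push_cast; rfl
    · rintro ⟨x, y⟩ hx
      have : (x, 0) ∈ D := hD (Prod.mk_le_mk.mpr ⟨le_rfl, zero_le⟩) hx
      simpa using (hg x 0).mp this
  have hVg : (D.card : ℝ) = ∑ k ∈ Finset.range a, (g k : ℝ) := by
    rw [Finset.card_eq_sum_card_fiberwise (f := Prod.snd) (t := Finset.range a)]
    · push_cast; rfl
    · rintro ⟨x, y⟩ hx
      have : (0, y) ∈ D := hD (Prod.mk_le_mk.mpr ⟨zero_le, le_rfl⟩) hx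
      simpa using (hf 0 y).mp this
  have hf1 := sum_range_mul_div (fun j => (f j : ℝ)) ha0 b
  have hg1 := sum_range_mul_div (fun j => (g j : ℝ)) hb0 a
  rw [← hVf] at hf1
  rw [← hVg, mul_comm b a] at hg1
  have haR : (0 : ℝ) < a := by exact_mod_cast ha0
  have hbR : (0 : ℝ) < b := by exact_mod_cast hb0
  set δ : ℝ := 1 / a + 1 / b with hδ
  have hδ0 : 0 < δ := by positivity
  -- The hypothesis is used at the extreme points of `D` on the two axes.
  have hab : (a : ℝ) + b ≤ N + 2 := by
    have h1 := h _ ((hg (b - 1) 0).mpr (by omega)) _ ((hf 0 (a - 1)).mpr (by omega))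
    have h2 : (((b - 1 + (a - 1) : ℕ)) : ℝ) ≤ N :=
      abs_le_of_sq_le_sq' (by nlinarith) hN |>.2
    have h3 : b - 1 + (a - 1) + 2 = b + a := by omega
    have h4 : (((b - 1 + (a - 1) : ℕ)) : ℝ) + 2 = b + a := by exact_mod_cast h3
    linarith
  -- Compare the last point of row `k` with the top point of column `j`. Rounding costs at most 2 in
  -- `j + k`, absorbed by enlarging the radius to `N + 2`.
  have hterm : ∀ r ∈ Finset.range (a * b),
      (f (r / a) : ℝ) + g (r / b) ≤ 2 + √((N + 2) ^ 2 - (δ * ((r + 1 : ℕ) : ℝ)) ^ 2) := by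
    intro r hr
    rw [Finset.mem_range] at hr
    set j := r / a with hj
    set k := r / b with hk
    have hjb : j < b := Nat.div_lt_of_lt_mul hr
    have hka : k < a := Nat.div_lt_of_lt_mul (by rwa [mul_comm])
    have hfj : 0 < f j := (hf j 0).mp ((hg j 0).mpr hjb)
    have hgk : 0 < g k := (hg 0 k).mp ((hf 0 k).mpr hka)
    have h1 := h _ ((hg (g k - 1) k).mpr (by omega)) _ ((hf j (f j - 1)).mpr (by omega))
    simp only at h1
    have e1 : ((g k - 1 + (f j - 1) : ℕ) : ℝ) = f j + g k - 2 := by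
      have : g k - 1 + (f j - 1) + 2 = f j + g k := by omega
      have : ((g k - 1 + (f j - 1) : ℕ) : ℝ) + 2 = f j + g k := by exact_mod_cast this
      linarith
    rw [e1] at h1
    push_cast at h1
    have hjk : (j : ℝ) + k ≤ N := abs_le_of_sq_le_sq' (by nlinarith) hN |>.2
    have hj1 : ((r + 1 : ℕ) : ℝ) / a ≤ j + 1 := by
      rw [div_le_iff₀ haR]
      have := Nat.lt_mul_div_succ r ha0
      have : r + 1 ≤ (j + 1) * a := by rw [mul_comm]; exact this
      exact_mod_cast this
    have hk1 : ((r + 1 : ℕ) : ℝ) / b ≤ k + 1 := by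
      rw [div_le_iff₀ hbR]
      have := Nat.lt_mul_div_succ r hb0
      have : r + 1 ≤ (k + 1) * b := by rw [mul_comm]; exact this
      exact_mod_cast this
    have hδr : δ * ((r + 1 : ℕ) : ℝ) ≤ j + k + 2 := by
      have : δ * ((r + 1 : ℕ) : ℝ) = ((r + 1 : ℕ) : ℝ) / a + ((r + 1 : ℕ) : ℝ) / b := by
        rw [hδ]; ring
      linarith
    have hδr0 : 0 ≤ δ * ((r + 1 : ℕ) : ℝ) := by positivity
    have : (f j : ℝ) + g k - 2 ≤ √((N + 2) ^ 2 - (δ * ((r + 1 : ℕ) : ℝ)) ^ 2) := by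
      refine Real.le_sqrt_of_sq_le ?_
      have := pow_le_pow_left₀ hδr0 hδr 2
      nlinarith
    linarith
  have hsum := Finset.sum_le_sum hterm
  rw [Finset.sum_add_distrib, Finset.sum_add_distrib, hf1, hg1] at hsum
  simp only [Finset.sum_const, Finset.card_range, nsmul_eq_mul, Nat.cast_mul] at hsum
  have hint := sum_sqrt_sq_sub_sq_le (R := N + 2) (by linarith) hδ0 (a * b)
  set T := ∑ r ∈ Finset.range (a * b), √((N + 2) ^ 2 - (δ * ((r + 1 : ℕ) : ℝ)) ^ 2)
  have hδab : δ * (a * b) = a + b := by rw [hδ]; field_simp; ring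
  have h5 : δ * ((a + b) * (D.card : ℝ)) ≤ 2 * (a + b) + Real.pi / 4 * (N + 2) ^ 2 := by
    calc δ * ((a + b) * (D.card : ℝ)) ≤ δ * (a * b * 2 + T) :=
          mul_le_mul_of_nonneg_left (by linarith) hδ0.le
      _ = 2 * (δ * (a * b)) + δ * T := by ring
      _ ≤ _ := by rw [hδab]; linarith
  -- AM–GM: equal width and height is the worst case.
  have h6 : 4 ≤ δ * (a + b) := by
    rw [hδ, ← sub_nonneg]
    have : (1 / (a : ℝ) + 1 / b) * (a + b) - 4 = (a - b) ^ 2 / (a * b) := by field_simp; ring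
    rw [this]
    positivity
  have h7 : 4 * (D.card : ℝ) ≤ δ * (a + b) * D.card :=
    mul_le_mul_of_nonneg_right h6 (Nat.cast_nonneg _)
  linarith

/-! ### Permutation sums and the upper bound -/

theorem card_mul_succ_le_two_mul_sum (s : Finset ℕ) (hs : ∀ x ∈ s, 1 ≤ x) :
    s.card * (s.card + 1) ≤ 2 * ∑ x ∈ s, x := by
  induction s using Finset.induction_on_max with
  | empty => simp
  | insert m s hm ih =>
    have hms : m ∉ s := fun h => lt_irrefl _ (hm m h)
    have hsub : s ⊆ Finset.Ico 1 m := fun x hx =>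
      Finset.mem_Ico.mpr ⟨hs x (Finset.mem_insert_of_mem hx), hm x hx⟩
    have hc := Finset.card_le_card hsub
    rw [Nat.card_Ico] at hc
    have hm1 := hs m (Finset.mem_insert_self m s)
    have ih := ih fun x hx => hs x (Finset.mem_insert_of_mem hx)
    rw [Finset.card_insert_of_notMem hms, Finset.sum_insert hms]
    have : s.card + 1 ≤ m := by omega
    nlinarith

theorem IsPermOf.card_sq_le_two_mul_sum {n : ℕ} {a : ℕ → ℕ} (ha : IsPermOf n a) {s : Finset ℕ}
    (hs : s ⊆ Finset.Icc 1 n) : s.card ^ 2 ≤ 2 * ∑ i ∈ s, a i := by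
  have hsub : (s : Set ℕ) ⊆ Set.Icc 1 n := by
    rw [← Finset.coe_Icc]
    exact Finset.coe_subset.mpr hs
  have hinj : Set.InjOn a s := ha.injOn.mono hsub
  have h := card_mul_succ_le_two_mul_sum (s.image a) (by
    intro x hx
    obtain ⟨i, hi, rfl⟩ := Finset.mem_image.mp hx
    exact (ha.mapsTo (hsub hi)).1)
  rw [Finset.card_image_of_injOn hinj, Finset.sum_image hinj] at h
  nlinarith

theorem IsPermOf.two_mul_sum {n : ℕ} {a : ℕ → ℕ} (ha : IsPermOf n a) :
    2 * ∑ i ∈ Finset.Icc 1 n, a i = n * (n + 1) := by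
  have himg : (Finset.Icc 1 n).image a = Finset.Icc 1 n := by
    apply Finset.coe_injective
    rw [Finset.coe_image, Finset.coe_Icc]
    exact ha.image_eq
  have hinj : Set.InjOn a (Finset.Icc 1 n : Finset ℕ) := by
    rw [Finset.coe_Icc]
    exact ha.injOn
  have h1 : ∑ i ∈ Finset.Icc 1 n, a i = ∑ i ∈ Finset.Icc 1 n, i := by
    conv_rhs => rw [← himg]
    rw [Finset.sum_image hinj]
  have h2 : ∑ i ∈ Finset.Icc 1 n, i = ∑ i ∈ Finset.range (n + 1), i := by
    rw [Finset.range_eq_Ico, Finset.sum_eq_sum_Ico_succ_bot (Nat.succ_pos n), zero_add]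
    rfl
  rw [h1, h2, mul_comm, Finset.sum_range_id_mul_two]
  simp [mul_comm]

/-- Pairs `(j, k)` such that the first `j` and the last `k` terms of `a` sum to at most half of
`1 + ⋯ + n`. -/
def smallComplements (n : ℕ) (a : ℕ → ℕ) : Finset (ℕ × ℕ) :=
  (Finset.range n ×ˢ Finset.range n).filter fun p =>
    4 * (∑ i ∈ Finset.Icc 1 p.1, a i + ∑ i ∈ Finset.Ioc (n - p.2) n, a i) ≤ n * (n + 1)

theorem isLowerSet_smallComplements (n : ℕ) (a : ℕ → ℕ) :
    IsLowerSet (smallComplements n a : Set (ℕ × ℕ)) := by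
  rintro ⟨j, k⟩ ⟨j', k'⟩ hle h
  obtain ⟨hj, hk⟩ := Prod.mk_le_mk.mp hle
  simp only [smallComplements, Finset.mem_coe, Finset.mem_filter, Finset.mem_product,
    Finset.mem_range] at h ⊢
  have h1 : ∑ i ∈ Finset.Icc 1 j', a i ≤ ∑ i ∈ Finset.Icc 1 j, a i :=
    Finset.sum_le_sum_of_subset (Finset.Icc_subset_Icc le_rfl hj)
  have h2 : ∑ i ∈ Finset.Ioc (n - k') n, a i ≤ ∑ i ∈ Finset.Ioc (n - k) n, a i :=
    Finset.sum_le_sum_of_subset (Finset.Ioc_subset_Ioc (by omega) le_rfl)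
  exact ⟨⟨by omega, by omega⟩, by omega⟩

theorem IsPermOf.add_sq_le {n : ℕ} {a : ℕ → ℕ} (ha : IsPermOf n a) {j k : ℕ} (hj : j ≤ n)
    (hk : k ≤ n) (hP : 4 * ∑ i ∈ Finset.Icc 1 j, a i ≤ n * (n + 1))
    (hQ : 4 * ∑ i ∈ Finset.Ioc (n - k) n, a i ≤ n * (n + 1)) :
    (j + k) ^ 2 ≤ 2 * (∑ i ∈ Finset.Icc 1 j, a i + ∑ i ∈ Finset.Ioc (n - k) n, a i) := by
  have htot := ha.two_mul_sum
  -- Prefix and suffix may come from different pairs, so disjointness needs proof: if they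
  -- overlapped, their sums would exceed the total, yet each is at most half of it.
  have hjk : j + k ≤ n := by
    by_contra hcon
    have hunion : Finset.Icc 1 j ∪ Finset.Ioc (n - k) n = Finset.Icc 1 n := by
      ext i; simp only [Finset.mem_union, Finset.mem_Icc, Finset.mem_Ioc]; omega
    have hjmem : j ∈ Finset.Icc 1 j ∩ Finset.Ioc (n - k) n := by
      simp only [Finset.mem_inter, Finset.mem_Icc, Finset.mem_Ioc]; omega
    have h := Finset.sum_union_inter (s₁ := Finset.Icc 1 j) (s₂ := Finset.Ioc (n - k) n) (f := a)
    rw [hunion] at h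
    have h1 := Finset.single_le_sum (f := a) (fun _ _ => Nat.zero_le _) hjmem
    have h2 : 1 ≤ a j := (ha.mapsTo (Set.mem_Icc.mpr ⟨by omega, hj⟩)).1
    omega
  have hdisj : Disjoint (Finset.Icc 1 j) (Finset.Ioc (n - k) n) := by
    rw [Finset.disjoint_left]
    intro i
    simp only [Finset.mem_Icc, Finset.mem_Ioc]
    omega
  have h := ha.card_sq_le_two_mul_sum (s := Finset.Icc 1 j ∪ Finset.Ioc (n - k) n) (by
    intro i
    simp only [Finset.mem_union, Finset.mem_Icc, Finset.mem_Ioc]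
    omega)
  rw [Finset.sum_union hdisj, Finset.card_union_of_disjoint hdisj, Nat.card_Icc, Nat.card_Ioc] at h
  rwa [show j + 1 - 1 + (n - (n - k)) = j + k by omega] at h

theorem IsPermOf.card_smallComplements_le {n : ℕ} {a : ℕ → ℕ} (ha : IsPermOf n a) :
    ((smallComplements n a).card : ℝ) ≤
      Real.pi / 16 * ((n : ℝ) + 3) ^ 2 + ((n : ℝ) + 3) / 2 := by
  have h := card_le_of_isLowerSet (isLowerSet_smallComplements n a) (N := (n : ℝ) + 1)
    (by positivity) (by
      rintro ⟨j, k⟩ hx ⟨j', k'⟩ hy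
      simp only [smallComplements, Finset.mem_filter, Finset.mem_product, Finset.mem_range]
        at hx hy
      -- Swapping the suffixes leaves the sum of all four partial sums unchanged.
      have h1 := ha.add_sq_le (j := j) (k := k') (by omega) (by omega) (by omega) (by omega)
      have h2 := ha.add_sq_le (j := j') (k := k) (by omega) (by omega) (by omega) (by omega)
      have h3 : (j + k') ^ 2 + (j' + k) ^ 2 ≤ (n + 1) ^ 2 := by
        have : n * (n + 1) ≤ (n + 1) ^ 2 := by nlinarith
        omega
      exact_mod_cast h3)
  refine h.trans (le_of_eq ?_)
  ring

theorem IsPermOf.mem_largeSums_iff {n : ℕ} {a : ℕ → ℕ} (ha : IsPermOf n a) {j k : ℕ}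
    (hjk : j + k < n) : (j + 1, n - k) ∈ largeSums n a ↔ (j, k) ∈ smallComplements n a := by
  have htot := ha.two_mul_sum
  have hsplit : ∑ i ∈ Finset.Icc 1 n, a i = ∑ i ∈ Finset.Icc 1 j, a i +
      ∑ i ∈ Finset.Icc (j + 1) (n - k), a i + ∑ i ∈ Finset.Ioc (n - k) n, a i := by
    rw [← Finset.sum_union, ← Finset.sum_union]
    · congr 1
      ext i
      simp only [Finset.mem_union, Finset.mem_Icc, Finset.mem_Ioc]
      omega
    all_goals
      rw [Finset.disjoint_left]
      intro i
      simp only [Finset.mem_union, Finset.mem_Icc, Finset.mem_Ioc]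
      omega
  have hchoose : (((n + 1).choose 2 : ℕ) : ℝ) = (n : ℝ) * (n + 1) / 2 := by
    rw [Nat.cast_choose_two]
    push_cast
    ring
  have hcond : (1 / 2 : ℝ) * ((n + 1).choose 2 : ℝ) ≤
        ∑ i ∈ Finset.Icc (j + 1) (n - k), (a i : ℝ) ↔
      n * (n + 1) ≤ 4 * ∑ i ∈ Finset.Icc (j + 1) (n - k), a i := by
    rw [hchoose, ← Nat.cast_le (α := ℝ)]
    push_cast
    constructor <;> intro h <;> linarith
  simp only [largeSums, smallComplements, Finset.mem_filter, Finset.mem_product, Finset.mem_Icc,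
    Finset.mem_range, hcond]
  constructor
  · rintro ⟨_, _, h⟩
    exact ⟨⟨by omega, by omega⟩, by omega⟩
  · rintro ⟨_, h⟩
    exact ⟨⟨by omega, by omega⟩, by omega, by omega⟩

theorem IsPermOf.card_largeSums_le_card_smallComplements {n : ℕ} {a : ℕ → ℕ}
    (ha : IsPermOf n a) : (largeSums n a).card ≤ (smallComplements n a).card := by
  have hbound : ∀ p ∈ largeSums n a, 1 ≤ p.1 ∧ p.1 ≤ p.2 ∧ p.2 ≤ n := by
    intro p hp
    simp only [largeSums, Finset.mem_filter, Finset.mem_product, Finset.mem_Icc] at hp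
    omega
  refine Finset.card_le_card_of_injOn (fun p => (p.1 - 1, n - p.2)) ?_ ?_
  · rintro ⟨u, v⟩ hp
    have hb := hbound _ hp
    simp only at hb
    refine (ha.mem_largeSums_iff (by omega)).mp ?_
    rw [show u - 1 + 1 = u by omega, show n - (n - v) = v by omega]
    exact hp
  · rintro ⟨u, v⟩ hp ⟨u', v'⟩ hp' heq
    have hb := hbound _ hp
    have hb' := hbound _ hp'
    simp only [Prod.mk.injEq] at heq hb hb' ⊢
    omega

/-! ### The tent permutation -/

theorem isPermOf_tentPerm (n : ℕ) : IsPermOf n (tentPerm n) := by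
  refine ⟨?_, ?_, ?_⟩
  · intro i hi
    simp only [Set.mem_Icc, tentPerm] at hi ⊢
    split_ifs <;> omega
  · intro i hi j hj hij
    simp only [Set.mem_Icc, tentPerm] at hi hj hij
    split_ifs at hij <;> omega
  · intro m hm
    simp only [Set.mem_Icc] at hm
    obtain ⟨c, hc⟩ := m.even_or_odd'
    rcases hc with rfl | rfl
    · refine ⟨c, Set.mem_Icc.mpr (by omega), ?_⟩
      simp only [tentPerm]
      split_ifs <;> omega
    · refine ⟨n - c, Set.mem_Icc.mpr (by omega), ?_⟩
      simp only [tentPerm]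
      split_ifs <;> omega

theorem sum_tentPerm_prefix {n j : ℕ} (hj : 2 * j ≤ n) :
    ∑ i ∈ Finset.Icc 1 j, tentPerm n i = j * (j + 1) := by
  induction j with
  | zero => simp
  | succ j ih =>
    rw [Finset.sum_Icc_succ_top (by omega), ih (by omega), tentPerm, if_pos hj]
    ring

theorem sum_tentPerm_suffix {n k : ℕ} (hk : 2 * k ≤ n) :
    ∑ i ∈ Finset.Ioc (n - k) n, tentPerm n i = k ^ 2 := by
  induction k with
  | zero => simp
  | succ k ih =>
    have hins : Finset.Ioc (n - (k + 1)) n = insert (n - k) (Finset.Ioc (n - k) n) := by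
      ext i
      simp only [Finset.mem_insert, Finset.mem_Ioc]
      omega
    rw [hins, Finset.sum_insert (by simp), ih (by omega), tentPerm, if_neg (by omega),
      show n - (n - k) = k by omega]
    ring

/-- The exact condition is `4 * (j * (j + 1) + k ^ 2) ≤ n * (n + 1)`; rounding it to a disc loses
only lower-order terms. -/
theorem mem_largeSums_tentPerm {n j k : ℕ} (h : 4 * ((j + 1) ^ 2 + k ^ 2) ≤ n ^ 2) :
    (j + 1, n - k) ∈ largeSums n (tentPerm n) := by
  have hj : 2 * (j + 1) ≤ n := by
    by_contra hcon
    nlinarith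
  have hk : 2 * k ≤ n := by
    by_contra hcon
    nlinarith
  rw [(isPermOf_tentPerm n).mem_largeSums_iff (by omega)]
  simp only [smallComplements, Finset.mem_filter, Finset.mem_product, Finset.mem_range]
  rw [sum_tentPerm_prefix (by omega), sum_tentPerm_suffix hk]
  exact ⟨⟨by omega, by omega⟩, by nlinarith⟩

theorem le_card_largeSums_tentPerm (n : ℕ) :
    Real.pi / 16 * (n : ℝ) ^ 2 - n / 2 ≤ ((largeSums n (tentPerm n)).card : ℝ) := by
  set R : ℝ := n / 2 with hR
  have hR0 : 0 ≤ R := by positivity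
  let F : ℝ → ℝ := fun x => √(R ^ 2 - x ^ 2)
  have hF : Continuous F := by fun_prop
  have hquarter : Real.pi / 16 * (n : ℝ) ^ 2 - n / 2 ≤
      ∑ j ∈ Finset.range (n / 2), F (1 + (j : ℕ)) := by
    have hanti : AntitoneOn F (Set.Icc 1 (1 + (n / 2 : ℕ))) :=
      (antitoneOn_sqrt_sq_sub_sq R).mono fun x hx => zero_le_one.trans hx.1
    refine le_trans ?_ hanti.integral_le_sum
    have hle : R ≤ 1 + (n / 2 : ℕ) := by
      have : n ≤ 2 * (1 + n / 2) := by omega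
      have : (n : ℝ) ≤ 2 * (1 + (n / 2 : ℕ)) := by exact_mod_cast this
      rw [hR]
      linarith
    have h1 := integral_sqrt_sq_sub_sq_of_le hR0 hle
    rw [← intervalIntegral.integral_add_adjacent_intervals (hF.intervalIntegrable 0 1)
      (hF.intervalIntegrable 1 _)] at h1
    have h2 : ∫ x in (0 : ℝ)..1, F x ≤ ∫ _x in (0 : ℝ)..1, R := by
      refine intervalIntegral.integral_mono_on zero_le_one (hF.intervalIntegrable 0 1)
        intervalIntegrable_const fun x _ => ?_
      exact (Real.sqrt_le_sqrt (by nlinarith [sq_nonneg x])).trans (Real.sqrt_sq hR0).le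
    simp only [intervalIntegral.integral_const, sub_zero, one_smul] at h2
    have h3 : Real.pi / 4 * R ^ 2 = Real.pi / 16 * (n : ℝ) ^ 2 := by rw [hR]; ring
    linarith
  refine hquarter.trans ?_
  -- Lattice points of the quarter disc; the `+ 1` counts `k = 0`, so each column has at least `F`
  -- points.
  let E : Finset (Σ _ : ℕ, ℕ) :=
    (Finset.range (n / 2)).sigma fun j => Finset.range (⌊F (1 + (j : ℕ))⌋₊ + 1)
  have hE : ∑ j ∈ Finset.range (n / 2), F (1 + (j : ℕ)) ≤ (E.card : ℝ) := by
    rw [Finset.card_sigma, Nat.cast_sum]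
    refine Finset.sum_le_sum fun j _ => ?_
    rw [Finset.card_range]
    push_cast
    exact (Nat.lt_floor_add_one _).le
  have hmem : ∀ p ∈ E, 2 * (p.1 + 1) ≤ n ∧ 4 * ((p.1 + 1) ^ 2 + p.2 ^ 2) ≤ n ^ 2 := by
    rintro ⟨j, k⟩ hp
    simp only [E, Finset.mem_sigma, Finset.mem_range] at hp
    obtain ⟨hj, hk⟩ := hp
    have hjn : 2 * (j + 1) ≤ n := by omega
    refine ⟨hjn, ?_⟩
    have hjR : (1 : ℝ) + j ≤ R := by
      have : (2 : ℝ) * (j + 1) ≤ n := by exact_mod_cast hjn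
      rw [hR]
      linarith
    have hkF : (k : ℝ) ≤ F (1 + j) :=
      (Nat.le_floor_iff (Real.sqrt_nonneg _)).mp (Nat.lt_succ_iff.mp hk)
    have hk2 :=
      (Real.le_sqrt (Nat.cast_nonneg k) (by nlinarith [(Nat.cast_nonneg j : (0 : ℝ) ≤ j)])).mp hkF
    have : (4 : ℝ) * (((j : ℝ) + 1) ^ 2 + (k : ℝ) ^ 2) ≤ (n : ℝ) ^ 2 := by
      rw [hR] at hk2
      nlinarith
    exact_mod_cast this
  refine hE.trans (Nat.cast_le.mpr ?_)
  refine Finset.card_le_card_of_injOn (fun p => (p.1 + 1, n - p.2)) ?_ ?_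
  · intro p hp
    exact mem_largeSums_tentPerm (hmem p hp).2
  · rintro ⟨j, k⟩ hp ⟨j', k'⟩ hp' heq
    have h1 := hmem _ hp
    have h2 := hmem _ hp'
    simp only [Prod.mk.injEq] at heq h1 h2
    have hk : k ≤ n := by nlinarith
    have hk' : k' ≤ n := by nlinarith
    obtain rfl : j = j' := by omega
    obtain rfl : k = k' := by omega
    rfl

theorem IsPermOf.card_largeSums_le {n : ℕ} {a : ℕ → ℕ} (ha : IsPermOf n a) :
    ((largeSums n a).card : ℝ) ≤ (Real.pi / 16 + 6 / n) * (n : ℝ) ^ 2 := by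
  rcases Nat.eq_zero_or_pos n with rfl | hn
  · simp [largeSums]
  have hn1 : (1 : ℝ) ≤ n := by exact_mod_cast hn
  have h1 : ((largeSums n a).card : ℝ) ≤ (smallComplements n a).card := by
    exact_mod_cast ha.card_largeSums_le_card_smallComplements
  have h2 := ha.card_smallComplements_le
  have h3 : (Real.pi / 16 + 6 / n) * (n : ℝ) ^ 2 = Real.pi / 16 * (n : ℝ) ^ 2 + 6 * n := by
    field_simp
  rw [h3]
  -- With `π ≤ 4` the error is at most `2 * n + 15 / 4`, which is below `6 * n` for `n ≥ 1`.
  nlinarith [Real.pi_le_four]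

theorem proposition5p3 :
    (∃ ε : ℕ → ℝ, Tendsto ε atTop (𝓝 0) ∧
      ∀ (n : ℕ) (a : ℕ → ℕ), IsPermOf n a →
        ((largeSums n a).card : ℝ) ≤ (Real.pi / 16 + ε n) * (n : ℝ) ^ 2) ∧
    (∀ n : ℕ, IsPermOf n (tentPerm n)) ∧
    Tendsto (fun n : ℕ => ((largeSums n (tentPerm n)).card : ℝ) / (n : ℝ) ^ 2)
      atTop (𝓝 (Real.pi / 16)) := by
  have hε : Tendsto (fun n : ℕ => (6 : ℝ) / n) atTop (𝓝 0) :=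
    tendsto_const_div_atTop_nhds_zero_nat 6
  refine ⟨⟨_, hε, fun n a ha => ha.card_largeSums_le⟩, isPermOf_tentPerm, ?_⟩
  have hlow : Tendsto (fun n : ℕ => Real.pi / 16 - (1 / 2 : ℝ) / n) atTop (𝓝 (Real.pi / 16)) := by
    simpa using (tendsto_const_div_atTop_nhds_zero_nat (1 / 2 : ℝ)).const_sub (Real.pi / 16)
  have hupp : Tendsto (fun n : ℕ => Real.pi / 16 + (6 : ℝ) / n) atTop (𝓝 (Real.pi / 16)) := by
    simpa using hε.const_add (Real.pi / 16)
  refine tendsto_of_tendsto_of_tendsto_of_le_of_le' hlow hupp ?_ ?_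
  · filter_upwards [eventually_gt_atTop 0] with n hn
    have hn0 : (0 : ℝ) < n := by exact_mod_cast hn
    rw [le_div_iff₀ (by positivity)]
    refine le_trans (le_of_eq ?_) (le_card_largeSums_tentPerm n)
    field_simp
  · filter_upwards [eventually_gt_atTop 0] with n hn
    have hn0 : (0 : ℝ) < n := by exact_mod_cast hn
    rw [div_le_iff₀ (by positivity)]
    exact (isPermOf_tentPerm n).card_largeSums_le
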